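/- Let $\mathbb{F}$ be a field, let $n\ge 1$, and let $\mathrm{Mat}_n(\mathbb{F})$ be the algebra of $n\times n$ matrices over $\mathbb{F}$. For $S\subseteq\mathrm{Mat}_n(\mathbb{F})$, a word of length $k\ge 0$ in $S$ is a product $a_1\cdots a_k$ with $a_1,\dots,a_k\in S$ (the empty product, the identity matrix, is the word of length $0$), and the length $\ell(S)$ is the smallest integer $k\ge 0$ such that the $\mathbb{F}$-linear span of the words in $S$ of length at most $k$ equals the (unital) $\mathbb{F}$-algebra generated by $S$. Let $\ell(\mathrm{Mat}_n(\mathbb{F}))$ be the maximum of $\ell(S)$ over all subsets $S$ that generate $\mathrm{Mat}_n(\mathbb{F})$ as an $\mathbb{F}$-algebra. Then $\ell(S)$ is well defined for every $S\subseteq\mathrm{Mat}_n(\mathbb{F})$, and $$\ell(S)\le 2n\log_2 n+4n-4 .$$ In particular, the maximum $\ell(\mathrm{Mat}_n(\mathbb{F}))$ exists and is at most $2n\log_2 n+4n-4$; hence there is an absolute constant $C$, independent of $\mathbb{F}$ and $n$, such that $\ell(\mathrm{Mat}_n(\mathbb{F}))\le C\,n\log n$ for all fields $\mathbb{F}$ and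 all $n\ge 2$. -/

import Mathlib

universe u

namespace MatrixLength

variable (F : Type*) [Field F] {A : Type*} [Ring A] [Algebra F A]

/-- The set `S ^ k` of words of length `k` in `S`: the products `a₁ ⋯ aₖ` with all `aᵢ ∈ S`.
The empty product `1` is the only word of length `0`. -/
def words (S : Set A) (k : ℕ) : Set A :=
  {a | ∃ l : List A, l.length = k ∧ (∀ x ∈ l, x ∈ S) ∧ l.prod = a}

/-- The `F`-linear span of all the words in `S` that have length at most `k`. -/
def wordSpan (S : Set A) (k : ℕ) : Submodule F A :=
  Submodule.span F {a | ∃ j ≤ k, a ∈ words S j}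

/-- Those `k` for which the words of length at most `k` span the (unital) subalgebra
generated by `S`. -/
def spanningLengths (S : Set A) : Set ℕ :=
  {k | wordSpan F S k = Subalgebra.toSubmodule (Algebra.adjoin F S)}

/-- The length `ℓ(S)`: the smallest `k` such that the words in `S` of length at most `k` span
the subalgebra generated by `S`. -/
noncomputable def setLength (S : Set A) : ℕ :=
  sInf (spanningLengths F S)

variable (A) in
/-- The lengths of the subsets of `A` that generate `A` as an `F`-algebra. -/
def generatingLengths : Set ℕ :=
  {m | ∃ S : Set A, Algebra.adjoin F S = ⊤ ∧ setLength F S = m}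

variable (A) in
/-- The length `ℓ(A)`: the maximum of `ℓ(S)` over all the subsets `S` of `A` that generate `A`
as an `F`-algebra. -/
noncomputable def algLength : ℕ :=
  sSup (generatingLengths F A)

end MatrixLength

/-!
If `W` is the span of `1` and `S`, the words of length at most `k` span `W ^ k`, and `k` is a
spanning length exactly when `W ^ (k + 1) ≤ W ^ k`. This condition descends from the algebraic
closure, and it is inherited by a module from a submodule with `k` and its quotient with `l`, at the
cost `k + l + 1`, which the superadditivity of `2 n log₂ n + 2 n - 2` absorbs. So the field may be
taken algebraically closed and the action irreducible. A rank one operator in `W ^ k` then gives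
every operator once it is multiplied by `n - 1` more letters on either side.

To reach rank one, start from the identity and decrease the rank `r` of `f ∈ W ^ k` without
increasing `k r + 2 n log₂ r`. Let `t` be the length of a shortest word `x` with `f x f` not a
multiple of `f`. If `t r ≤ 3 n`, a polynomial in `f x`, namely its minimal polynomial on the range
of `f` without a suitable linear factor, lowers the rank. Otherwise the scalars in `f y f` for
shorter words `y` yield a short `d` with `d f ≠ 0` such that `f w d f ≠ 0` forces `w` to be long.
The ranges which the suffixes of a shortest such `w` produce then need so much room that
`f w d f` has rank at most `r / 2`.
-/

namespace MatrixLength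

open Module Submodule

section Powers

variable {R A : Type*} [CommSemiring R] [Semiring A] [Algebra R A] {W : Submodule R A}

theorem pow_mul_le_of_pow_succ_mul_le (h1 : 1 ≤ W) {Z : Submodule R A} {i : ℕ}
    (h : W ^ (i + 1) * Z ≤ W ^ i * Z) (j : ℕ) : W ^ j * Z ≤ W ^ i * Z := by
  induction j with
  | zero => exact mul_le_mul_left (pow_le_pow_right' h1 (Nat.zero_le i)) Z
  | succ j ih =>
    calc W ^ (j + 1) * Z = W * (W ^ j * Z) := by rw [pow_succ', mul_assoc]
      _ ≤ W * (W ^ i * Z) := mul_le_mul_right ih W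
      _ = W ^ (i + 1) * Z := by rw [pow_succ', mul_assoc]
      _ ≤ W ^ i * Z := h

theorem pow_le_of_pow_succ_le (h1 : 1 ≤ W) {i : ℕ} (h : W ^ (i + 1) ≤ W ^ i) (j : ℕ) :
    W ^ j ≤ W ^ i := by
  simpa only [mul_one] using
    pow_mul_le_of_pow_succ_mul_le h1 (Z := 1) (by simpa only [mul_one] using h) j

open scoped Pointwise in
theorem mem_pow_of_mem_set_pow {i : ℕ} {x : A} (hx : x ∈ (W : Set A) ^ i) : x ∈ W ^ i := by
  rw [pow_eq_span_pow_set]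
  exact subset_span hx

open scoped Pointwise in
theorem exists_mem_set_pow_mul_mul_ne_zero {a b : A} {t : ℕ}
    (h : ∃ x ∈ W ^ t, a * x * b ≠ 0) : ∃ w ∈ (W : Set A) ^ t, a * w * b ≠ 0 := by
  by_contra! hzero
  obtain ⟨x, hx, hne⟩ := h
  have hle : W ^ t ≤ (LinearMap.mulRight R b ∘ₗ LinearMap.mulLeft R a).ker := by
    rw [pow_eq_span_pow_set]
    exact span_le.2 hzero
  exact hne (hle hx)

end Powers

section Rank

variable {K V : Type*} [Field K] [AddCommGroup V] [Module K V]

/-- The rank of an endomorphism as a natural number, so that it can be counted with and compared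
to dimensions. It is meant for finite-dimensional spaces: an infinite rank becomes `0`. -/
noncomputable def natRank (f : End K V) : ℕ := finrank K f.range

theorem natRank_zero : natRank (0 : End K V) = 0 := by
  rw [natRank, LinearMap.range_zero, finrank_bot]

variable [FiniteDimensional K V]

theorem natRank_pos {f : End K V} (hf : f ≠ 0) : 0 < natRank f :=
  Submodule.one_le_finrank_iff.2 fun h => hf (LinearMap.range_eq_bot.1 h)

theorem finrank_add_finrank_le_of_le_map {L M N : Submodule K V} {f : End K V} (hLM : L ≤ M)
    (hL : L ≤ f.ker) (hN : N ≤ M.map f) : finrank K L + finrank K N ≤ finrank K M := by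
  have hrank := LinearMap.finrank_range_add_finrank_ker (f.domRestrict M)
  rw [LinearMap.range_domRestrict, LinearMap.ker_domRestrict] at hrank
  have hNle : finrank K N ≤ finrank K (M.map f) := finrank_mono hN
  have hLle : finrank K L ≤ finrank K (comap M.subtype f.ker) := by
    rw [← (comapSubtypeEquivOfLe hLM).finrank_eq]
    exact finrank_mono (comap_mono hL)
  omega

theorem finrank_smul_range_add_natRank_le {P Q : Submodule K (End K V)} {f g q : End K V}
    (hPQ : P ≤ Q) (hP : ∀ p ∈ P, f * p * g = 0) (hq : q ∈ Q) :
    finrank K (P • g.range : Submodule K V) + natRank (f * q * g) ≤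
      finrank K (Q • g.range : Submodule K V) := by
  refine finrank_add_finrank_le_of_le_map (f := f) (smul_mono_left hPQ) ?_ ?_
  · refine smul_le.2 ?_
    rintro p hp _ ⟨v, rfl⟩
    exact LinearMap.congr_fun (hP p hp) v
  · rintro _ ⟨v, rfl⟩
    exact ⟨q (g v), smul_mem_smul hq ⟨v, rfl⟩, rfl⟩

end Rank

section Irreducible

variable {K V : Type*} [Field K] [AddCommGroup V] [Module K V]

/-- No proper nonzero subspace of `V` is invariant under all the operators in `W`. It is a property
of a space of operators, not of the algebra they generate, because words are counted in `W`. -/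
def ActsIrreducibly (W : Submodule K (End K V)) : Prop :=
  ∀ U : Submodule K V, W • U ≤ U → U = ⊥ ∨ U = ⊤

variable {W : Submodule K (End K V)} [FiniteDimensional K V]

theorem ActsIrreducibly.min_le_finrank_pow_smul (hW : ActsIrreducibly W) (h1 : 1 ≤ W)
    {U : Submodule K V} (hU : U ≠ ⊥) (i : ℕ) :
    min (finrank K V) (i + 1) ≤ finrank K (W ^ i • U : Submodule K V) := by
  induction i with
  | zero =>
    rw [pow_zero, Submodule.one_smul]
    exact (min_le_right _ _).trans (Submodule.one_le_finrank_iff.2 hU)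
  | succ i ih =>
    have hmono : W ^ i • U ≤ W ^ (i + 1) • U :=
      smul_mono_left (pow_le_pow_right' h1 (Nat.le_succ i))
    obtain hlt | heq := hmono.lt_or_eq
    · have := finrank_lt_finrank_of_lt hlt
      omega
    have hinv : W • (W ^ i • U) ≤ W ^ i • U := by
      rw [← Submodule.smul_assoc, smul_eq_mul, ← pow_succ', ← heq]
    obtain hbot | htop := hW _ hinv
    · have hle : U ≤ W ^ i • U := by
        simpa only [Submodule.one_smul] using
          smul_mono_left (N := U) (one_le_pow_of_one_le' h1 i)
      exact absurd (le_bot_iff.1 (hle.trans hbot.le)) hU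
    · rw [← heq, htop, finrank_top]
      exact min_le_left _ _

theorem ActsIrreducibly.pow_smul_eq_top (hW : ActsIrreducibly W) (h1 : 1 ≤ W)
    {U : Submodule K V} (hU : U ≠ ⊥) : W ^ (finrank K V - 1) • U = ⊤ := by
  refine eq_top_of_finrank_eq (le_antisymm (Submodule.finrank_le _) ?_)
  have := hW.min_le_finrank_pow_smul h1 hU (finrank K V - 1)
  omega

theorem ActsIrreducibly.exists_mul_mul_ne_zero (hW : ActsIrreducibly W) (h1 : 1 ≤ W)
    {f g : End K V} (hf : f ≠ 0) (hg : g ≠ 0) :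
    ∃ x ∈ W ^ (finrank K V - 1), f * x * g ≠ 0 := by
  by_contra! h
  have htop := hW.pow_smul_eq_top h1 (mt LinearMap.range_eq_bot.1 hg)
  have hker : (⊤ : Submodule K V) ≤ f.ker := by
    rw [← htop]
    refine smul_le.2 ?_
    rintro x hx _ ⟨v, rfl⟩
    exact LinearMap.congr_fun (h x hx) v
  exact hf (LinearMap.ker_eq_top.1 (top_le_iff.1 hker))

theorem ActsIrreducibly.exists_mul_mul_notMem_span (hW : ActsIrreducibly W) (h1 : 1 ≤ W)
    {f : End K V} (hf : 2 ≤ natRank f) :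
    ∃ x ∈ W ^ (finrank K V - 1), f * x * f ∉ span K {f} := by
  by_contra! h
  obtain ⟨v, hv⟩ : ∃ v, f v ≠ 0 := by
    by_contra! hzero
    rw [LinearMap.ext (g := 0) hzero, natRank_zero] at hf
    omega
  have htop := hW.pow_smul_eq_top h1 (U := span K {f v}) (by simpa using hv)
  have hrange : f.range ≤ span K {f v} := by
    rw [LinearMap.range_eq_map, ← htop, map_le_iff_le_comap]
    refine smul_le.2 fun x hx u hu => ?_
    obtain ⟨c, rfl⟩ := mem_span_singleton.1 hu
    obtain ⟨d, hd⟩ := mem_span_singleton.1 (h x hx)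
    rw [mem_comap, Module.End.smul_def, map_smul, map_smul]
    exact smul_mem _ c (mem_span_singleton.2 ⟨d, LinearMap.congr_fun hd v⟩)
  have hle : natRank f ≤ 1 := (finrank_mono hrange).trans (finrank_span_singleton hv).le
  omega

open scoped Pointwise in
/-- The subspaces `W ^ i • g.range` grow by `natRank (f * p * q * g)` at each step, because the
part of the word to the left of its last `i` letters annihilates the previous one. -/
theorem mul_natRank_le_finrank_pow_smul (h1 : 1 ≤ W) {f g : End K V} {t : ℕ}
    (hlt : ∀ j < t, ∀ x ∈ W ^ j, f * x * g = 0) {i j : ℕ} (hij : j + i = t) {p q : End K V}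
    (hp : p ∈ W ^ j) (hq : q ∈ (W : Set (End K V)) ^ i) :
    (i + 1) * natRank (f * p * q * g) ≤ finrank K (W ^ i • g.range : Submodule K V) := by
  induction i generalizing j p q with
  | zero =>
    obtain rfl : q = 1 := by simpa using hq
    have hrange : (f * p * 1 * g).range = g.range.map (f * p) := by
      rw [mul_one, Module.End.mul_eq_comp, LinearMap.range_comp]
    rw [zero_add, one_mul, pow_zero, Submodule.one_smul, natRank, hrange]
    exact finrank_map_le _ _
  | succ i ih =>
    have hvanish : ∀ x ∈ W ^ i, f * p * x * g = 0 := fun x hx => by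
      rw [mul_assoc f]
      exact hlt (j + i) (by omega) _ (pow_add W j i ▸ mul_mem_mul hp hx)
    have hstep := finrank_smul_range_add_natRank_le (pow_le_pow_right' h1 (Nat.le_succ i))
      hvanish (mem_pow_of_mem_set_pow hq)
    rw [pow_succ'] at hq
    obtain ⟨w, hw, q', hq', rfl⟩ := Set.mem_mul.1 hq
    have hrec := ih (j := j + 1) (by omega) (pow_succ W j ▸ mul_mem_mul hp hw) hq'
    rw [show f * p * (w * q') * g = f * (p * w) * q' * g by simp only [mul_assoc]] at hstep ⊢
    calc (i + 1 + 1) * natRank (f * (p * w) * q' * g)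
        = (i + 1) * natRank (f * (p * w) * q' * g) + natRank (f * (p * w) * q' * g) :=
          Nat.succ_mul _ _
      _ ≤ _ := (Nat.add_le_add_right hrec _).trans hstep

theorem exists_mul_mul_natRank_le (h1 : 1 ≤ W) {f g : End K V}
    (h : ∃ t, ∃ x ∈ W ^ t, f * x * g ≠ 0) :
    ∃ t, ∃ w ∈ W ^ t, f * w * g ≠ 0 ∧ (t + 1) * natRank (f * w * g) ≤ finrank K V := by
  classical
  obtain ⟨w, hw, hne⟩ := exists_mem_set_pow_mul_mul_ne_zero (Nat.find_spec h)
  have hlt : ∀ j < Nat.find h, ∀ x ∈ W ^ j, f * x * g = 0 := fun j hj => by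
    simpa only [not_exists, not_and, not_not] using Nat.find_min h hj
  have hle := mul_natRank_le_finrank_pow_smul h1 hlt (zero_add _) (p := 1)
    (by simpa only [pow_zero] using Submodule.one_le.1 le_rfl) hw
  rw [mul_one] at hle
  exact ⟨_, w, mem_pow_of_mem_set_pow hw, hne, hle.trans (Submodule.finrank_le _)⟩

end Irreducible

section Polynomials

open Polynomial

variable {K V : Type*} [Field K] [AddCommGroup V] [Module K V]

theorem aeval_comp_eq_comp_aeval {U : Type*} [AddCommGroup U] [Module K U] {T : End K U}
    {S : End K V} {g : U →ₗ[K] V} (h : S ∘ₗ g = g ∘ₗ T) (q : K[X]) :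
    aeval S q ∘ₗ g = g ∘ₗ aeval T q := by
  induction q using Polynomial.induction_on' with
  | add p q hp hq => rw [map_add, map_add, LinearMap.add_comp, LinearMap.comp_add, hp, hq]
  | monomial i c =>
    rw [← smul_X_eq_monomial, map_smul, map_smul, aeval_X_pow, aeval_X_pow, LinearMap.smul_comp,
      LinearMap.comp_smul, Module.End.commute_pow_left_of_commute h]

theorem aeval_mem_pow {R A : Type*} [CommSemiring R] [Semiring A] [Algebra R A]
    {W : Submodule R A} (h1 : 1 ≤ W) {x : A} (hx : x ∈ W) (q : R[X]) :
    aeval x q ∈ W ^ q.natDegree := by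
  rw [aeval_eq_sum_range]
  refine sum_mem fun i hi => smul_mem _ _ ?_
  exact pow_le_pow_right' h1 (Finset.mem_range_succ_iff.1 hi) (pow_mem_pow W hx i)

variable [FiniteDimensional K V]

/-- A case of Frobenius' rank inequality. -/
theorem natRank_mul_add_natRank_mul_le {f g h : End K V} (hzero : f * (g * h) = 0) :
    natRank (g * h) + natRank (f * g) ≤ natRank g := by
  refine finrank_add_finrank_le_of_le_map (f := f) (LinearMap.range_comp_le_range h g) ?_
    (LinearMap.range_comp g f).le
  rintro _ ⟨v, rfl⟩
  exact LinearMap.congr_fun hzero v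

theorem natRank_aeval_prod_add_le {T : End K V} {m : K[X]} (hm : aeval T m = 0) {r : ℕ}
    (hr : ∀ a q, (X - C a) * q = m → r ≤ natRank (aeval T q)) (s : Multiset K)
    (hs : (s.map fun a => X - C a).prod ∣ m) :
    natRank (aeval T (s.map fun a => X - C a).prod) + s.card * r ≤ finrank K V := by
  induction s using Multiset.induction with
  | empty =>
    rw [Multiset.card_zero, zero_mul, add_zero]
    exact Submodule.finrank_le _
  | cons a s ih =>
    rw [Multiset.map_cons, Multiset.prod_cons] at hs ⊢
    set p := (s.map fun a => X - C a).prod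
    obtain ⟨u, rfl⟩ := hs
    have hzero : aeval T (X - C a) * (aeval T p * aeval T u) = 0 := by
      rw [← map_mul, ← map_mul, ← mul_assoc, hm]
    have hstep := natRank_mul_add_natRank_mul_le hzero
    rw [← map_mul, ← map_mul] at hstep
    have hle := hr a (p * u) (mul_assoc _ _ _).symm
    have hrec := ih ((Dvd.intro_left _ rfl).mul_right u)
    rw [Multiset.card_cons, add_mul, one_mul]
    omega

theorem exists_natRank_aeval_le [IsAlgClosed K] [Nontrivial V] (T : End K V) :
    ∃ q : K[X], q.natDegree + 1 = (minpoly K T).natDegree ∧ aeval T q ≠ 0 ∧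
      (minpoly K T).natDegree * natRank (aeval T q) ≤ finrank K V := by
  set m := minpoly K T
  have hmonic : m.Monic := minpoly.monic (Algebra.IsIntegral.isIntegral T)
  have hm : aeval T m = 0 := minpoly.aeval K T
  have hsplit := IsAlgClosed.splits m
  obtain ⟨a₀, ha₀⟩ := IsAlgClosed.exists_root m (minpoly.degree_pos
    (Algebra.IsIntegral.isIntegral T)).ne'
  obtain ⟨q, ⟨a, hq⟩, hmin⟩ := exists_minimalFor_of_wellFoundedLT
    (fun q : K[X] => ∃ a, (X - C a) * q = m) (fun q => natRank (aeval T q))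
    ⟨_, a₀, mul_divByMonic_eq_iff_isRoot.2 ha₀⟩
  have hqmonic : q.Monic := (monic_X_sub_C a).of_mul_monic_left (hq.symm ▸ hmonic)
  have hdeg : q.natDegree + 1 = m.natDegree := by
    rw [← hq, (monic_X_sub_C a).natDegree_mul hqmonic, natDegree_X_sub_C, add_comm]
  refine ⟨q, hdeg, fun hzero => ?_, ?_⟩
  · have hle : m.natDegree ≤ q.natDegree :=
      natDegree_le_natDegree (minpoly.degree_le_of_ne_zero K T hqmonic.ne_zero hzero)
    omega
  · have hprod := hsplit.eq_prod_roots_of_monic hmonic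
    have hle := natRank_aeval_prod_add_le hm (r := natRank (aeval T q))
      (fun b p hp => (le_total _ _).elim (hmin ⟨b, hp⟩) id) m.roots hprod.symm.dvd
    rw [← hprod, hm, natRank_zero, zero_add, ← hsplit.natDegree_eq_card_roots] at hle
    exact hle

theorem exists_natRank_aeval_mul_le [IsAlgClosed K] {f x : End K V}
    (hx : f * x * f ∉ span K {f}) : ∃ q : K[X], 1 ≤ q.natDegree ∧ aeval (f * x) q * f ≠ 0 ∧
      (q.natDegree + 1) * natRank (aeval (f * x) q * f) ≤ natRank f := by
  set T : End K f.range := f.rangeRestrict ∘ₗ x ∘ₗ f.range.subtype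
  have hf : f ≠ 0 := by
    rintro rfl
    exact hx (by simp)
  have : Nontrivial f.range := nontrivial_iff_ne_bot.2 (mt LinearMap.range_eq_bot.1 hf)
  have haeval (q : K[X]) :
      aeval (f * x) q * f = f.range.subtype ∘ₗ aeval T q ∘ₗ f.rangeRestrict := by
    rw [← LinearMap.comp_assoc, ← aeval_comp_eq_comp_aeval (T := T) (S := f * x) rfl]
    rfl
  have hrank (q : K[X]) : natRank (aeval (f * x) q * f) = natRank (aeval T q) := by
    rw [haeval, natRank, LinearMap.range_comp, LinearMap.range_comp, LinearMap.range_rangeRestrict,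
      finrank_map_subtype_eq, ← LinearMap.range_eq_map, natRank]
  have hscalar : T ∉ (algebraMap K (End K f.range)).range := by
    rintro ⟨c, hc⟩
    refine hx (mem_span_singleton.2 ⟨c, LinearMap.ext fun v => ?_⟩)
    exact congrArg Subtype.val (LinearMap.congr_fun hc (f.rangeRestrict v))
  have hdeg := (minpoly.two_le_natDegree_iff (Algebra.IsIntegral.isIntegral T)).2 hscalar
  obtain ⟨q, hq, hne, hle⟩ := exists_natRank_aeval_le T
  refine ⟨q, by omega, fun hzero => (natRank_pos hne).ne' ?_, ?_⟩
  · rw [← hrank, hzero, natRank_zero]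
  · rw [hq, hrank]
    exact hle

end Polynomials

section Gap

variable {K : Type*} [Field K]

theorem exists_mem_forall_bilin_sub_eq_zero {M N : Type*} [AddCommGroup M] [Module K M]
    [AddCommGroup N] [Module K N] [FiniteDimensional K N] (Φ : M →ₗ[K] Dual K N)
    {X : Submodule K M} {Z : Submodule K N} {e : N}
    (h : ∀ x ∈ X, (∀ z ∈ Z, Φ x z = 0) → Φ x e = 0) : ∃ z ∈ Z, ∀ x ∈ X, Φ x (e - z) = 0 := by
  have he : e ∈ (X.map Φ ⊓ Z.dualAnnihilator).dualCoannihilator := by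
    rw [mem_dualCoannihilator]
    rintro _ ⟨⟨x, hx, rfl⟩, hxZ⟩
    exact h x hx ((mem_dualAnnihilator _).1 hxZ)
  rw [← Subspace.dualCoannihilator_dualAnnihilator_eq (W := X.map Φ), ← dualAnnihilator_sup_eq,
    Subspace.dualAnnihilator_dualCoannihilator_eq] at he
  obtain ⟨y, hy, z, hz, rfl⟩ := mem_sup.1 he
  refine ⟨z, hz, fun x hx => ?_⟩
  rw [add_sub_cancel_right]
  exact (mem_dualCoannihilator y).1 hy _ (mem_map_of_mem hx)

section Algebra

variable {R : Type*} [Ring R] [Algebra K R] {W : Submodule K R} {a : R} {t : ℕ}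

theorem exists_mul_notMem_pow_mul_span (h1 : 1 ≤ W)
    (hscalar : ∀ j < t, ∀ x ∈ W ^ j, a * x * a ∈ span K {a})
    (hex : ∃ x ∈ W ^ t, a * x * a ∉ span K {a}) {i : ℕ} (hi : i < t) :
    ∃ y ∈ W ^ (i + 1), y * a ∉ W ^ i * span K {a} := by
  by_contra! h
  have hle : W ^ (i + 1) * span K {a} ≤ W ^ i * span K {a} := fun z hz => by
    obtain ⟨y, hy, rfl⟩ := mem_mul_span_singleton.1 hz
    exact h y hy
  obtain ⟨x, hx, hxa⟩ := hex
  obtain ⟨z, hz, hza⟩ := mem_mul_span_singleton.1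
    (pow_mul_le_of_pow_succ_mul_le h1 hle t (mul_mem_mul hx (mem_span_singleton_self a)))
  refine hxa ?_
  rw [mul_assoc, ← hza, ← mul_assoc]
  exact hscalar i hi z hz

/-- The alternative is a duality: if no `x ∈ W ^ j` separates `y * a` from `W ^ i * a` under the
pairing `(x, z) ↦ a * x * z`, then some `y * a - z * a` is orthogonal to all of `W ^ j`. -/
theorem exists_mul_eq_zero_or_exists_mul_ne_zero [FiniteDimensional K R] (h1 : 1 ≤ W) (ha : a ≠ 0)
    (hscalar : ∀ j < t, ∀ x ∈ W ^ j, a * x * a ∈ span K {a}) {i j : ℕ} (hij : i + 1 + j < t)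
    {y : R} (hy : y ∈ W ^ (i + 1)) (hya : y * a ∉ W ^ i * span K {a}) :
    (∃ d ∈ W ^ (i + 1), d * a ≠ 0 ∧ ∀ x ∈ W ^ j, a * x * (d * a) = 0) ∨
      ∃ x ∈ W ^ j, (∀ z ∈ W ^ i, a * x * z * a = 0) ∧ a * x * y * a ≠ 0 := by
  obtain ⟨φ, hφ⟩ := Projective.exists_dual_eq_one K ha
  have hspan : ∀ z ∈ span K {a}, φ z = 0 → z = 0 := fun z hz hz0 => by
    obtain ⟨c, rfl⟩ := mem_span_singleton.1 hz
    rw [map_smul, hφ, smul_eq_mul, mul_one] at hz0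
    rw [hz0, zero_smul]
  have hφ_eq_zero : ∀ x ∈ W ^ j, ∀ z ∈ W ^ (i + 1),
      φ (a * x * (z * a)) = 0 → a * x * z * a = 0 := by
    intro x hx z hz h0
    have hxz : x * z ∈ W ^ (j + (i + 1)) := pow_add W j (i + 1) ▸ mul_mem_mul hx hz
    have hmem := hscalar _ (by omega) _ hxz
    simp only [← mul_assoc] at h0 hmem
    exact hspan _ hmem h0
  let Φ : R →ₗ[K] Dual K R := ((LinearMap.mul K R).comp (LinearMap.mulLeft K a)).compr₂ φ
  have hmono : W ^ i ≤ W ^ (i + 1) := pow_le_pow_right' h1 (Nat.le_succ i)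
  by_contra! ⟨hd, hx⟩
  obtain ⟨z, hz, hort⟩ := exists_mem_forall_bilin_sub_eq_zero Φ (X := W ^ j)
    (Z := W ^ i * span K {a}) (e := y * a) fun x hxj hxZ => by
      have hxya := hx x hxj fun z hz => hφ_eq_zero x hxj z (hmono hz)
        (hxZ _ (mul_mem_mul hz (mem_span_singleton_self a)))
      change φ (a * x * (y * a)) = 0
      rw [← mul_assoc, hxya, map_zero]
  obtain ⟨z, hzW, rfl⟩ := mem_mul_span_singleton.1 hz
  have hyz : y - z ∈ W ^ (i + 1) := sub_mem hy (hmono hzW)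
  obtain ⟨x, hxj, hne⟩ := hd (y - z) hyz fun h0 => hya <| by
    rw [sub_mul, sub_eq_zero] at h0
    rwa [h0]
  have hx0 : φ (a * x * ((y - z) * a)) = 0 := by
    rw [sub_mul]
    exact hort x hxj
  exact hne (by rw [← mul_assoc, hφ_eq_zero x hxj _ hyz hx0])

end Algebra

variable {V : Type*} [AddCommGroup V] [Module K V] [FiniteDimensional K V]
  {W : Submodule K (End K V)} {f : End K V} {t : ℕ}

theorem exists_mul_eq_zero_or_mul_natRank_le (h1 : 1 ≤ W) (hf : f ≠ 0)
    (hscalar : ∀ j < t, ∀ x ∈ W ^ j, f * x * f ∈ span K {f})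
    (hex : ∃ x ∈ W ^ t, f * x * f ∉ span K {f}) {i : ℕ} (hi : i < t) :
    (∃ b ≤ i, ∃ j, b + j + 1 = t ∧ ∃ d ∈ W ^ b, d * f ≠ 0 ∧ ∀ x ∈ W ^ j, f * x * (d * f) = 0) ∨
      (i + 1) * natRank f ≤ finrank K (W ^ i • f.range : Submodule K V) := by
  induction i with
  | zero =>
    right
    rw [zero_add, one_mul, pow_zero, Submodule.one_smul, natRank]
  | succ i ih =>
    obtain ⟨b, hb, hgap⟩ | hle := ih (by omega)
    · exact .inl ⟨b, hb.trans (Nat.le_succ i), hgap⟩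
    obtain ⟨y, hy, hyf⟩ := exists_mul_notMem_pow_mul_span h1 hscalar hex (i := i) (by omega)
    obtain ⟨j, hj⟩ : ∃ j, i + 1 + j + 1 = t := ⟨t - (i + 2), by omega⟩
    obtain hd | ⟨x, hx, hzero, hne⟩ :=
      exists_mul_eq_zero_or_exists_mul_ne_zero h1 hf hscalar (j := j) (by omega) hy hyf
    · exact .inl ⟨i + 1, le_rfl, j, hj, hd⟩
    right
    have hmem : f * x * y * f ∈ span K {f} := by
      rw [mul_assoc f]
      exact hscalar (j + (i + 1)) (by omega) _ (pow_add W j (i + 1) ▸ mul_mem_mul hx hy)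
    have hrank : natRank (f * x * y * f) = natRank f := by
      obtain ⟨c, hc⟩ := mem_span_singleton.1 hmem
      have hc0 : c ≠ 0 := by
        rintro rfl
        exact hne (by rw [← hc, zero_smul])
      rw [← hc, natRank, LinearMap.range_smul _ _ hc0, natRank]
    have hstep := finrank_smul_range_add_natRank_le (pow_le_pow_right' h1 (Nat.le_succ i)) hzero hy
    rw [hrank] at hstep
    exact (Nat.succ_mul _ _).trans_le ((Nat.add_le_add_right hle _).trans hstep)

theorem exists_mul_eq_zero_of_finrank_lt (h1 : 1 ≤ W) (hf : f ≠ 0)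
    (hscalar : ∀ j < t, ∀ x ∈ W ^ j, f * x * f ∈ span K {f})
    (hex : ∃ x ∈ W ^ t, f * x * f ∉ span K {f}) (ht : finrank K V < t * natRank f) :
    ∃ b j, b + j + 1 = t ∧ b * natRank f ≤ finrank K V ∧
      ∃ d ∈ W ^ b, d * f ≠ 0 ∧ ∀ x ∈ W ^ j, f * x * (d * f) = 0 := by
  have hpos := natRank_pos hf
  obtain ⟨b, hb, j, hbj, hd⟩ | hle := exists_mul_eq_zero_or_mul_natRank_le h1 hf hscalar hex
    ((Nat.div_lt_iff_lt_mul hpos).2 ht)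
  · exact ⟨b, j, hbj, (Nat.le_div_iff_mul_le hpos).1 hb, hd⟩
  · have hlt := (Nat.div_lt_iff_lt_mul hpos).1 (Nat.lt_succ_self (finrank K V / natRank f))
    exact absurd (hle.trans (Submodule.finrank_le _)) hlt.not_ge

end Gap

section Descent

theorem three_mul_le_logb {e : ℕ} (he : 1 ≤ e) :
    (3 * e : ℝ) ≤ 2 * (e + 1 : ℕ) * Real.logb 2 (e + 1 : ℕ) := by
  obtain rfl | he2 := he.eq_or_lt
  · norm_num
  · have hlog : (3 : ℝ) ≤ 2 * Real.logb 2 (e + 1 : ℕ) := by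
      have hcast : (3 : ℝ) ≤ (e + 1 : ℕ) := by exact_mod_cast Nat.succ_le_succ he2
      calc (3 : ℝ) = Real.logb 2 (2 ^ 3) := by
            rw [Real.logb_pow, Real.logb_self_eq_one one_lt_two]; norm_num
        _ ≤ Real.logb 2 ((e + 1 : ℕ) ^ 2) :=
            Real.logb_le_logb_of_le one_lt_two (by norm_num) (by nlinarith)
        _ = 2 * Real.logb 2 (e + 1 : ℕ) := by rw [Real.logb_pow]; norm_num
    push_cast at hlog ⊢
    nlinarith [(Nat.cast_nonneg e : (0 : ℝ) ≤ e)]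

/-- The quantity that does not grow when an operator of rank `r` in `W ^ k`, on an `n`-dimensional
space, is replaced by one of smaller rank on the way to rank one. -/
noncomputable def potential (n k r : ℕ) : ℝ := k * r + 2 * n * Real.logb 2 r

theorem potential_le_potential {n k k' r r' d : ℕ} (hd : 0 < d) (hr' : 0 < r') (hr : d * r' ≤ r)
    (hk : (k' * r' : ℝ) ≤ k * r + 2 * n * Real.logb 2 d) :
    potential n k' r' ≤ potential n k r := by
  have hd0 : (0 : ℝ) < d := Nat.cast_pos.2 hd
  have hr0 : (0 : ℝ) < r' := Nat.cast_pos.2 hr'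
  have hlog : Real.logb 2 d + Real.logb 2 r' ≤ Real.logb 2 r := by
    rw [← Real.logb_mul hd0.ne' hr0.ne']
    exact Real.logb_le_logb_of_le one_lt_two (by positivity) (by exact_mod_cast hr)
  have := mul_le_mul_of_nonneg_left hlog (by positivity : (0 : ℝ) ≤ 2 * n)
  rw [potential, potential]
  linarith

variable {K V : Type*} [Field K] [AddCommGroup V] [Module K V] [FiniteDimensional K V]
  {W : Submodule K (End K V)} {f x : End K V} {k t : ℕ}

theorem exists_potential_le_of_mul_natRank_le [IsAlgClosed K] (h1 : 1 ≤ W) (hf : f ∈ W ^ k)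
    (hx : x ∈ W ^ t) (hxf : f * x * f ∉ span K {f}) (ht : t * natRank f ≤ 3 * finrank K V) :
    ∃ k', ∃ g ∈ W ^ k', g ≠ 0 ∧ natRank g < natRank f ∧
      potential (finrank K V) k' (natRank g) ≤ potential (finrank K V) k (natRank f) := by
  obtain ⟨q, hq, hne, hrank⟩ := exists_natRank_aeval_mul_le hxf
  have hpos := natRank_pos hne
  have hmem : Polynomial.aeval (f * x) q * f ∈ W ^ ((k + t) * q.natDegree + k) := by
    rw [pow_add, pow_mul]
    refine mul_mem_mul (aeval_mem_pow (one_le_pow_of_one_le' h1 _) ?_ q) hf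
    exact pow_add W k t ▸ mul_mem_mul hf hx
  set e := q.natDegree
  set r' := natRank (Polynomial.aeval (f * x) q * f)
  refine ⟨_, _, hmem, hne, by nlinarith, potential_le_potential e.succ_pos hpos hrank ?_⟩
  have hrank' : ((e + 1 : ℕ) * r' : ℝ) ≤ natRank f := by exact_mod_cast hrank
  have ht' : (t * natRank f : ℝ) ≤ 3 * finrank K V := by exact_mod_cast ht
  have hword : (e + 1 : ℕ) * (e * t * r' : ℝ) ≤
      (e + 1 : ℕ) * (2 * finrank K V * Real.logb 2 (e + 1 : ℕ)) :=
    calc (e + 1 : ℕ) * (e * t * r' : ℝ) = e * t * ((e + 1 : ℕ) * r') := by ring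
      _ ≤ e * t * natRank f := by gcongr
      _ = e * (t * natRank f) := by ring
      _ ≤ e * (3 * finrank K V) := by gcongr
      _ = finrank K V * (3 * e) := by ring
      _ ≤ finrank K V * (2 * (e + 1 : ℕ) * Real.logb 2 (e + 1 : ℕ)) := by
          exact mul_le_mul_of_nonneg_left (three_mul_le_logb hq) (Nat.cast_nonneg _)
      _ = _ := by ring
  calc (((k + t) * e + k : ℕ) * r' : ℝ) = k * ((e + 1 : ℕ) * r') + e * t * r' := by
        push_cast
        ring
    _ ≤ k * natRank f + 2 * finrank K V * Real.logb 2 (e + 1 : ℕ) :=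
        add_le_add (by gcongr) (le_of_mul_le_mul_left hword (by positivity))

theorem exists_potential_le_of_lt_mul_natRank (hW : ActsIrreducibly W) (h1 : 1 ≤ W)
    (hf : f ∈ W ^ k) (hf0 : f ≠ 0) (hscalar : ∀ j < t, ∀ x ∈ W ^ j, f * x * f ∈ span K {f})
    (hex : ∃ x ∈ W ^ t, f * x * f ∉ span K {f}) (ht : 3 * finrank K V < t * natRank f) :
    ∃ k', ∃ g ∈ W ^ k', g ≠ 0 ∧ natRank g < natRank f ∧
      potential (finrank K V) k' (natRank g) ≤ potential (finrank K V) k (natRank f) := by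
  obtain ⟨b, j, hbj, hb, d, hd, hdf, hgap⟩ :=
    exists_mul_eq_zero_of_finrank_lt h1 hf0 hscalar hex (by omega)
  obtain ⟨s, w, hw, hne, hrank⟩ :=
    exists_mul_mul_natRank_le h1 ⟨_, hW.exists_mul_mul_ne_zero h1 hf0 hdf⟩
  have hjs : j < s := by
    by_contra! hsj
    exact hne (hgap w (pow_le_pow_right' h1 hsj hw))
  have hpos := natRank_pos hne
  have hmem : f * w * (d * f) ∈ W ^ (k + s + (b + k)) := by
    rw [pow_add, pow_add W k, pow_add W b]
    exact mul_mem_mul (mul_mem_mul hf hw) (mul_mem_mul hd hf)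
  set n := finrank K V
  set r := natRank f
  set r' := natRank (f * w * (d * f))
  have hlong : 2 * n < (s + 1) * r := by
    have : t * r ≤ (b + (s + 1)) * r := Nat.mul_le_mul_right r (by omega)
    rw [add_mul b] at this
    omega
  have hhalf : 2 * r' ≤ r := by
    refine Nat.le_of_mul_le_mul_left ?_ (Nat.succ_pos s)
    linarith
  refine ⟨_, _, hmem, hne, by omega, potential_le_potential two_pos hpos hhalf ?_⟩
  have hk : (k + s + (b + k)) * r' ≤ k * r + 2 * n := by
    have hk2 : k * (2 * r') ≤ k * r := Nat.mul_le_mul_left k hhalf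
    have hb2 : b * (2 * r') ≤ b * r := Nat.mul_le_mul_left b hhalf
    nlinarith
  rw [Nat.cast_ofNat, Real.logb_self_eq_one one_lt_two, mul_one]
  exact_mod_cast hk

theorem exists_natRank_lt_potential_le [IsAlgClosed K] (hW : ActsIrreducibly W) (h1 : 1 ≤ W)
    (hf : f ∈ W ^ k) (hrank : 2 ≤ natRank f) :
    ∃ k', ∃ g ∈ W ^ k', g ≠ 0 ∧ natRank g < natRank f ∧
      potential (finrank K V) k' (natRank g) ≤ potential (finrank K V) k (natRank f) := by
  classical
  have hf0 : f ≠ 0 := by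
    rintro rfl
    rw [natRank_zero] at hrank
    omega
  have hex : ∃ t, ∃ x ∈ W ^ t, f * x * f ∉ span K {f} :=
    ⟨_, hW.exists_mul_mul_notMem_span h1 hrank⟩
  have hscalar : ∀ j < Nat.find hex, ∀ x ∈ W ^ j, f * x * f ∈ span K {f} := fun j hj => by
    simpa only [not_exists, not_and, not_not] using Nat.find_min hex hj
  obtain hle | hlt := le_or_gt (Nat.find hex * natRank f) (3 * finrank K V)
  · obtain ⟨x, hx, hxf⟩ := Nat.find_spec hex
    exact exists_potential_le_of_mul_natRank_le h1 hf hx hxf hle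
  · exact exists_potential_le_of_lt_mul_natRank hW h1 hf hf0 hscalar (Nat.find_spec hex) hlt

theorem exists_natRank_eq_one [IsAlgClosed K] (hW : ActsIrreducibly W) (h1 : 1 ≤ W)
    (hf : f ∈ W ^ k) (hf0 : f ≠ 0) :
    ∃ k' : ℕ, (k' : ℝ) ≤ potential (finrank K V) k (natRank f) ∧ ∃ g ∈ W ^ k', natRank g = 1 := by
  induction hr : natRank f using Nat.strong_induction_on generalizing f k with
  | _ r ih =>
    subst hr
    obtain hone | hrank := (Nat.succ_le_of_lt (natRank_pos hf0)).eq_or_lt'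
    · exact ⟨k, by simp [potential, hone], f, hf, hone⟩
    · obtain ⟨l, g, hg, hg0, hlt, hle⟩ := exists_natRank_lt_potential_le hW h1 hf hrank
      obtain ⟨k', hk', h⟩ := ih _ hlt hg hg0 rfl
      exact ⟨k', hk'.trans hle, h⟩

end Descent

section Bound

/-- The bound for the length of a set of operators on an `n`-dimensional space. At `n = 0`, where
`Real.logb 2 0 = 0`, it has the meaningless value `-2`. -/
noncomputable def lengthBound (n : ℕ) : ℝ := 2 * n * Real.logb 2 n + 2 * n - 2

theorem lengthBound_add_lengthBound_le {a b : ℕ} (ha : 1 ≤ a) (hb : 1 ≤ b) :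
    lengthBound a + lengthBound b + 1 ≤ lengthBound (a + b) := by
  have ha' : (1 : ℝ) ≤ a := by exact_mod_cast ha
  have hb' : (1 : ℝ) ≤ b := by exact_mod_cast hb
  have hloga : Real.logb 2 a ≤ Real.logb 2 (a + b) :=
    Real.logb_le_logb_of_le one_lt_two (by linarith) (by linarith)
  have hlogb : Real.logb 2 b ≤ Real.logb 2 (a + b) :=
    Real.logb_le_logb_of_le one_lt_two (by linarith) (by linarith)
  have hmula := mul_le_mul_of_nonneg_left hloga (by positivity : (0 : ℝ) ≤ 2 * a)
  have hmulb := mul_le_mul_of_nonneg_left hlogb (by positivity : (0 : ℝ) ≤ 2 * b)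
  push_cast [lengthBound]
  linarith

theorem lengthBound_le {n : ℕ} (hn : 1 ≤ n) :
    lengthBound n ≤ 2 * n * Real.logb 2 n + 4 * n - 4 := by
  have : (1 : ℝ) ≤ n := by exact_mod_cast hn
  rw [lengthBound]
  linarith

theorem lengthBound_le_mul_log {n : ℕ} (hn : 2 ≤ n) :
    lengthBound n ≤ 4 / Real.log 2 * (n * Real.log n) := by
  have hlogb : 1 ≤ Real.logb 2 n := by
    rw [← Real.logb_self_eq_one one_lt_two]
    exact Real.logb_le_logb_of_le one_lt_two two_pos (by exact_mod_cast hn)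
  calc lengthBound n ≤ 4 * (n * Real.logb 2 n) := by
        have := mul_le_mul_of_nonneg_left hlogb (Nat.cast_nonneg n)
        rw [lengthBound]
        linarith
    _ = 4 / Real.log 2 * (n * Real.log n) := by
        rw [Real.logb]
        ring

end Bound

section RankOne

variable {K V : Type*} [Field K] [AddCommGroup V] [Module K V]

theorem exists_eq_smulRight_of_natRank_eq_one {f : End K V} (hf : natRank f = 1) :
    ∃ (ξ : Dual K V) (a : V), f = ξ.smulRight a := by
  obtain ⟨a, ha, hspan⟩ := finrank_eq_one_iff'.1 hf
  obtain ⟨ψ, hψ⟩ := Projective.exists_dual_eq_one K (Subtype.coe_ne_coe.2 ha)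
  refine ⟨ψ ∘ₗ f, a, LinearMap.ext fun v => ?_⟩
  obtain ⟨c, hc⟩ := hspan ⟨f v, v, rfl⟩
  have hcv : c • (a : V) = f v := congrArg Subtype.val hc
  rw [LinearMap.smulRight_apply, LinearMap.comp_apply, ← hcv, map_smul, hψ, smul_eq_mul, mul_one]

variable [FiniteDimensional K V]

theorem span_smulRight_eq_top :
    span K (Set.range fun p : Dual K V × V => p.1.smulRight p.2) = ⊤ := by
  refine eq_top_iff.2 fun f _ => ?_
  let b := Module.finBasis K V
  have hf : f = ∑ i, (b.coord i).smulRight (f (b i)) :=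
    b.ext fun j => by simp [LinearMap.sum_apply, Finsupp.single_apply]
  rw [hf]
  exact sum_mem fun i _ => subset_span ⟨(b.coord i, f (b i)), rfl⟩

theorem mul_span_smulRight_mul_eq_top {P Q : Submodule K (End K V)} {ξ : Dual K V} {a : V}
    (hP : P • span K {a} = ⊤) (hQ : Q.map (LinearMap.llcomp K V V K ξ) = ⊤) :
    P * span K {ξ.smulRight a} * Q = ⊤ := by
  rw [eq_top_iff, ← span_smulRight_eq_top, span_le]
  rintro _ ⟨⟨η, v⟩, rfl⟩
  obtain ⟨y, hy, rfl⟩ : η ∈ Q.map (LinearMap.llcomp K V V K ξ) := hQ ▸ mem_top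
  have hle : P • span K {a} ≤ (P * span K {ξ.smulRight a} * Q).comap
      (LinearMap.smulRightₗ (LinearMap.llcomp K V V K ξ y)) := by
    refine smul_le.2 fun x hx u hu => ?_
    obtain ⟨c, rfl⟩ := mem_span_singleton.1 hu
    have heq : LinearMap.smulRightₗ (LinearMap.llcomp K V V K ξ y) (x • c • a) =
        c • (x * ξ.smulRight a * y) := by
      ext v
      simp [smul_comm c]
    rw [mem_comap, heq]
    exact smul_mem _ c (mul_mem_mul (mul_mem_mul hx (mem_span_singleton_self _)) hy)
  exact hle (hP ▸ mem_top)

variable {W : Submodule K (End K V)}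

theorem ActsIrreducibly.map_llcomp_pow_eq_top (hW : ActsIrreducibly W) (h1 : 1 ≤ W)
    {ξ : Dual K V} (hξ : ξ ≠ 0) :
    (W ^ (finrank K V - 1)).map (LinearMap.llcomp K V V K ξ) = ⊤ := by
  rw [← Subspace.dualCoannihilator_dualAnnihilator_eq
    (W := (W ^ (finrank K V - 1)).map (LinearMap.llcomp K V V K ξ))]
  suffices h : ((W ^ (finrank K V - 1)).map (LinearMap.llcomp K V V K ξ)).dualCoannihilator = ⊥ by
    rw [h, dualAnnihilator_bot]
  by_contra hne
  have hker : ⊤ ≤ ξ.ker := by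
    rw [← hW.pow_smul_eq_top h1 hne]
    exact smul_le.2 fun x hx v hv => (mem_dualCoannihilator v).1 hv _ (mem_map_of_mem hx)
  exact hξ (LinearMap.ker_eq_top.1 (top_le_iff.1 hker))

theorem ActsIrreducibly.pow_eq_top_of_natRank_eq_one (hW : ActsIrreducibly W) (h1 : 1 ≤ W) {k : ℕ}
    {f : End K V} (hf : f ∈ W ^ k) (hrank : natRank f = 1) :
    W ^ (finrank K V - 1 + k + (finrank K V - 1)) = ⊤ := by
  obtain ⟨ξ, a, rfl⟩ := exists_eq_smulRight_of_natRank_eq_one hrank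
  have hξ : ξ ≠ 0 := by
    rintro rfl
    simp [natRank_zero] at hrank
  have ha : a ≠ 0 := by
    rintro rfl
    simp [natRank_zero] at hrank
  have htop := mul_span_smulRight_mul_eq_top
    (hW.pow_smul_eq_top h1 (mt span_singleton_eq_bot.1 ha)) (hW.map_llcomp_pow_eq_top h1 hξ)
  have hle : span K {ξ.smulRight a} ≤ W ^ k := (span_singleton_le_iff_mem _ _).2 hf
  rw [eq_top_iff, ← htop, pow_add, pow_add]
  gcongr

theorem ActsIrreducibly.exists_pow_eq_top [IsAlgClosed K] [Nontrivial V] (hW : ActsIrreducibly W)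
    (h1 : 1 ≤ W) : ∃ k : ℕ, (k : ℝ) ≤ lengthBound (finrank K V) ∧ W ^ k = ⊤ := by
  have hone : (1 : End K V) ∈ W ^ 0 := by simpa only [pow_zero] using Submodule.one_le.1 le_rfl
  obtain ⟨k, hk, f, hf, hrank⟩ := exists_natRank_eq_one hW h1 hone one_ne_zero
  refine ⟨_, ?_, hW.pow_eq_top_of_natRank_eq_one h1 hf hrank⟩
  have hid : natRank (1 : End K V) = finrank K V := by
    rw [natRank, Module.End.one_eq_id, LinearMap.range_id, finrank_top]
  rw [hid, potential, Nat.cast_zero, zero_mul, zero_add] at hk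
  push_cast [lengthBound, Nat.cast_sub (finrank_pos : 0 < finrank K V)]
  linarith

end RankOne

section Reducible

variable {K R : Type*} [Field K] [Ring R] [Algebra K R] {W : Submodule K R}

/-- Every element of `W ^ (k + 1)` acts on `V` as some element of `W ^ k`. Unlike the inclusion
`W ^ (k + 1) ≤ W ^ k` this makes sense on submodules and quotients of a faithful module. -/
def StabilizesOn (W : Submodule K R) (k : ℕ) (V : Type*) [AddCommGroup V] [Module R V] : Prop :=
  ∀ x ∈ W ^ (k + 1), ∃ y ∈ W ^ k, ∀ v : V, x • v = y • v

theorem StabilizesOn.of_submodule_of_quotient {V : Type*} [AddCommGroup V] [Module R V]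
    (h1 : 1 ≤ W) (U : Submodule R V) {k l : ℕ} (hU : StabilizesOn W k U)
    (hQ : StabilizesOn W l (V ⧸ U)) : StabilizesOn W (k + l + 1) V := by
  intro x hx
  rw [show k + l + 1 + 1 = (k + 1) + (l + 1) by ring, pow_add] at hx
  induction hx using Submodule.mul_induction_on' with
  | mem_mul_mem a ha b hb =>
    obtain ⟨a', ha', haU⟩ := hU a ha
    obtain ⟨b', hb', hbQ⟩ := hQ b hb
    refine ⟨a' * b + a * b' - a' * b', sub_mem (add_mem ?_ ?_) ?_, fun v => ?_⟩
    · rw [add_assoc, pow_add]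
      exact mul_mem_mul ha' hb
    · rw [add_right_comm, pow_add]
      exact mul_mem_mul ha hb'
    · refine pow_le_pow_right' h1 (Nat.le_succ (k + l)) ?_
      rw [pow_add]
      exact mul_mem_mul ha' hb'
    · have hmem : b • v - b' • v ∈ U := by
        rw [← Submodule.Quotient.eq]
        exact hbQ (Submodule.Quotient.mk v)
      -- `b - b'` maps `V` into `U`, where `a - a'` vanishes, so `(a - a') * (b - b')` acts as `0`.
      have hprod : a • (b • v - b' • v) = a' • (b • v - b' • v) :=
        congrArg Subtype.val (haU ⟨_, hmem⟩)
      rw [sub_smul, add_smul, ← sub_eq_zero]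
      simp only [smul_sub, smul_smul] at hprod
      rw [← sub_eq_zero] at hprod
      rw [← hprod]
      abel
  | add a _ b _ ha hb =>
    obtain ⟨a', ha', haa'⟩ := ha
    obtain ⟨b', hb', hbb'⟩ := hb
    exact ⟨a' + b', add_mem ha' hb', fun v => by rw [add_smul, add_smul, haa', hbb']⟩

theorem actsIrreducibly_map_lsmul {V : Type*} [AddCommGroup V] [Module K V] [Module R V]
    [IsScalarTower K R V] [IsSimpleModule R V] (hgen : Algebra.adjoin K (W : Set R) = ⊤) :
    ActsIrreducibly (W.map (Algebra.lsmul K K V).toLinearMap) := by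
  intro U hU
  have hsmul (r : R) : ∀ u ∈ U, r • u ∈ U := by
    have hr : r ∈ Algebra.adjoin K (W : Set R) := hgen ▸ Algebra.mem_top
    induction hr using Algebra.adjoin_induction with
    | mem x hx => exact fun u hu => hU (smul_mem_smul (mem_map_of_mem hx) hu)
    | algebraMap c => exact fun u hu => (algebraMap_smul R c u).symm ▸ U.smul_mem c hu
    | add x y _ _ hx hy => exact fun u hu => (add_smul x y u).symm ▸ add_mem (hx u hu) (hy u hu)
    | mul x y _ _ hx hy => exact fun u hu => (mul_smul x y u).symm ▸ hx _ (hy u hu)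
  let U' : Submodule R V := { U with smul_mem' := fun r u hu => hsmul r u hu }
  refine (eq_bot_or_eq_top U').imp (fun h => ?_) (fun h => ?_)
  · exact SetLike.coe_injective (congrArg SetLike.coe h :)
  · exact SetLike.coe_injective (congrArg SetLike.coe h :)

theorem exists_stabilizesOn_of_isSimpleModule [IsAlgClosed K] {V : Type*} [AddCommGroup V]
    [Module K V] [Module R V] [IsScalarTower K R V] [FiniteDimensional K V] [IsSimpleModule R V]
    (h1 : 1 ≤ W) (hgen : Algebra.adjoin K (W : Set R) = ⊤) :
    ∃ k : ℕ, (k : ℝ) ≤ lengthBound (finrank K V) ∧ StabilizesOn W k V := by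
  have : Nontrivial V := IsSimpleModule.nontrivial R V
  have hone : 1 ≤ W.map (Algebra.lsmul K K V).toLinearMap :=
    Submodule.one_le.2 ⟨1, Submodule.one_le.1 h1, map_one (Algebra.lsmul K K V)⟩
  obtain ⟨k, hk, htop⟩ := (actsIrreducibly_map_lsmul (V := V) hgen).exists_pow_eq_top hone
  refine ⟨k, hk, fun x _ => ?_⟩
  rw [← Submodule.map_pow] at htop
  obtain ⟨y, hy, hxy⟩ : Algebra.lsmul K K V x ∈ (W ^ k).map (Algebra.lsmul K K V).toLinearMap :=
    htop ▸ mem_top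
  exact ⟨y, hy, fun v => (LinearMap.congr_fun hxy v).symm⟩

theorem exists_stabilizesOn.{v} [IsAlgClosed K] (h1 : 1 ≤ W)
    (hgen : Algebra.adjoin K (W : Set R) = ⊤) (V : Type v) [AddCommGroup V] [Module K V]
    [Module R V] [IsScalarTower K R V] [FiniteDimensional K V] [Nontrivial V] :
    ∃ k : ℕ, (k : ℝ) ≤ lengthBound (finrank K V) ∧ StabilizesOn W k V := by
  induction hn : finrank K V using Nat.strong_induction_on generalizing V with
  | _ n ih =>
    subst hn
    by_cases hV : IsSimpleModule R V
    · exact exists_stabilizesOn_of_isSimpleModule h1 hgen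
    obtain ⟨U, hbot, htop⟩ : ∃ U : Submodule R V, U ≠ ⊥ ∧ U ≠ ⊤ := by
      by_contra! h
      exact hV ((isSimpleModule_iff R V).2 ⟨fun U => or_iff_not_imp_left.2 (h U)⟩)
    have hsum : finrank K U + finrank K (V ⧸ U) = finrank K V :=
      (add_comm _ _).trans (finrank_quotient_add_finrank (U.restrictScalars K))
    have : Nontrivial U := Submodule.nontrivial_iff_ne_bot.2 hbot
    have : Nontrivial (V ⧸ U) := Submodule.Quotient.nontrivial_iff.2 htop
    have : FiniteDimensional K U := inferInstanceAs (FiniteDimensional K (U.restrictScalars K))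
    have : FiniteDimensional K (V ⧸ U) :=
      inferInstanceAs (FiniteDimensional K (V ⧸ U.restrictScalars K))
    have hU : 1 ≤ finrank K U := finrank_pos
    have hQ : 1 ≤ finrank K (V ⧸ U) := finrank_pos
    obtain ⟨k, hk, hkU⟩ := ih _ (by omega) U rfl
    obtain ⟨l, hl, hlQ⟩ := ih _ (by omega) (V ⧸ U) rfl
    refine ⟨_, ?_, hkU.of_submodule_of_quotient h1 U hlQ⟩
    rw [← hsum]
    push_cast
    linarith [lengthBound_add_lengthBound_le hU hQ]

theorem exists_pow_succ_le_of_isAlgClosed {V : Type*} [AddCommGroup V] [Module K V]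
    [FiniteDimensional K V] [Nontrivial V] [IsAlgClosed K] {W : Submodule K (End K V)}
    (h1 : 1 ≤ W) : ∃ k : ℕ, (k : ℝ) ≤ lengthBound (finrank K V) ∧ W ^ (k + 1) ≤ W ^ k := by
  set R := Algebra.adjoin K (W : Set (End K V))
  have hmap : (W.comap R.val.toLinearMap).map R.val.toLinearMap = W :=
    map_comap_eq_of_le fun x hx => ⟨⟨x, Algebra.subset_adjoin hx⟩, rfl⟩
  have hid : (1 : End K V) ∈ W := Submodule.one_le.1 h1
  have hone : 1 ≤ W.comap R.val.toLinearMap := Submodule.one_le.2 hid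
  obtain ⟨k, hk, hstab⟩ := exists_stabilizesOn hone
    (Algebra.adjoin_adjoin_coe_preimage (s := (W : Set (End K V)))) V
  refine ⟨k, hk, ?_⟩
  rw [← hmap, ← Submodule.map_pow, ← Submodule.map_pow]
  rintro _ ⟨x, hx, rfl⟩
  obtain ⟨y, hy, hxy⟩ := hstab x hx
  exact ⟨y, hy, (LinearMap.ext hxy).symm⟩

end Reducible

section BaseChange

variable {F K : Type*} [Field F] [Field K] [Algebra F K]

open scoped Pointwise in
theorem mem_span_of_mem_span_image {M N : Type*} [AddCommGroup M] [Module F M] [AddCommGroup N]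
    [Module F N] [Module K N] [IsScalarTower F K N] {φ : M → N} {ψ : N →ₗ[F] M} {π : K →ₗ[F] F}
    (h1 : π 1 = 1) (hψ : ∀ c m, ψ (c • φ m) = π c • m) {Y : Set M} {x : M}
    (hx : φ x ∈ span K (φ '' Y)) : x ∈ span F Y := by
  have hspan : span F ((Set.univ : Set K) • (φ '' Y)) = (span K (φ '' Y)).restrictScalars F :=
    span_smul_of_span_eq_top span_univ _
  have hle : (span K (φ '' Y)).restrictScalars F ≤ (span F Y).comap ψ := by
    rw [← hspan, span_le]
    rintro _ ⟨c, -, _, ⟨y, hy, rfl⟩, rfl⟩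
    change ψ (c • φ y) ∈ span F Y
    exact (hψ c y).symm ▸ smul_mem _ _ (subset_span hy)
  have hψx : ψ (φ x) = x := by simpa only [one_smul, h1] using hψ 1 x
  exact hψx ▸ hle hx

variable {V : Type*} [AddCommGroup V] [Module F V]

open scoped TensorProduct in
theorem mem_span_of_baseChange_mem_span {Y : Set (End F V)} {f : End F V}
    (hf : End.baseChangeHom F K V f ∈ span K (End.baseChangeHom F K V '' Y)) : f ∈ span F Y := by
  obtain ⟨π, hπ⟩ := LinearMap.exists_leftInverse_of_injective (Algebra.linearMap F K)
    (LinearMap.ker_eq_bot.2 (algebraMap F K).injective)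
  have hπ1 : π 1 = 1 := by simpa using LinearMap.congr_fun hπ 1
  let ψ : End K (K ⊗[F] V) →ₗ[F] End F V :=
    LinearMap.lcomp F V (TensorProduct.mk F K V 1) ∘ₗ
      LinearMap.compRight F ((TensorProduct.lid F V).toLinearMap ∘ₗ π.rTensor V) ∘ₗ
      LinearMap.restrictScalarsₗ F K (K ⊗[F] V) (K ⊗[F] V) F
  refine mem_span_of_mem_span_image (φ := End.baseChangeHom F K V) (ψ := ψ) hπ1 (fun c g => ?_) hf
  ext v
  change TensorProduct.lid F V (π.rTensor V (c • g.baseChange K (1 ⊗ₜ v))) = π c • g v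
  simp [TensorProduct.smul_tmul']

open scoped Pointwise in
theorem exists_pow_succ_le [FiniteDimensional F V] [Nontrivial V] {W : Submodule F (End F V)}
    (h1 : 1 ≤ W) : ∃ k : ℕ, (k : ℝ) ≤ lengthBound (finrank F V) ∧ W ^ (k + 1) ≤ W ^ k := by
  let φ := End.baseChangeHom F (AlgebraicClosure F) V
  have hpow (j : ℕ) : span (AlgebraicClosure F) (φ '' W) ^ j =
      span (AlgebraicClosure F) (φ '' (W : Set (End F V)) ^ j) := by
    rw [span_pow, Set.image_pow]
  have hone : 1 ≤ span (AlgebraicClosure F) (φ '' W) :=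
    Submodule.one_le.2 (subset_span ⟨1, Submodule.one_le.1 h1, map_one φ⟩)
  obtain ⟨k, hk, hle⟩ := exists_pow_succ_le_of_isAlgClosed hone
  rw [finrank_baseChange] at hk
  refine ⟨k, hk, ?_⟩
  rw [hpow, hpow] at hle
  rw [pow_eq_span_pow_set, pow_eq_span_pow_set, span_le]
  exact fun x hx => mem_span_of_baseChange_mem_span (hle (subset_span ⟨x, hx, rfl⟩))

end BaseChange

section Words

variable {F A : Type*} [Field F] [Ring A] [Algebra F A] {S : Set A}

theorem one_le_span_insert_one : 1 ≤ span F (insert 1 S) :=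
  Submodule.one_le.2 (subset_span (Set.mem_insert 1 S))

theorem words_zero : words S 0 = {1} := by
  ext a
  simp [words, eq_comm]

open scoped Pointwise in
theorem words_succ (k : ℕ) : words S (k + 1) = S * words S k := by
  ext a
  constructor
  · rintro ⟨_ | ⟨s, l⟩, hl, hS, rfl⟩
    · simp at hl
    · rw [List.forall_mem_cons] at hS
      exact ⟨s, hS.1, l.prod, ⟨l, Nat.succ.inj hl, hS.2, rfl⟩, List.prod_cons.symm⟩
  · rintro ⟨s, hs, _, ⟨l, hl, hS, rfl⟩, rfl⟩
    exact ⟨s :: l, by simp [hl], List.forall_mem_cons.2 ⟨hs, hS⟩, List.prod_cons⟩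

open scoped Pointwise in
theorem words_eq_pow (k : ℕ) : words S k = S ^ k := by
  induction k with
  | zero => rw [words_zero, pow_zero, Set.singleton_one]
  | succ k ih => rw [words_succ, ih, pow_succ']

open scoped Pointwise in
theorem insert_one_pow_eq_setOf_exists_mem_pow (k : ℕ) :
    insert 1 S ^ k = {a | ∃ j ≤ k, a ∈ S ^ j} := by
  induction k with
  | zero =>
    ext a
    simp
  | succ k ih =>
    rw [pow_succ', ih]
    ext a
    constructor
    · rintro ⟨s, rfl | hs, b, ⟨j, hj, hb⟩, rfl⟩
      · exact ⟨j, by omega, by simpa using hb⟩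
      · exact ⟨j + 1, by omega, pow_succ' S j ▸ Set.mul_mem_mul hs hb⟩
    · rintro ⟨_ | j, hj, ha⟩
      · exact ⟨1, Set.mem_insert 1 S, a, ⟨0, by omega, ha⟩, one_mul a⟩
      · rw [pow_succ'] at ha
        obtain ⟨s, hs, b, hb, rfl⟩ := ha
        exact Set.mul_mem_mul (Set.mem_insert_of_mem 1 hs) ⟨j, by omega, hb⟩

theorem wordSpan_eq_pow (k : ℕ) : wordSpan F S k = span F (insert 1 S) ^ k := by
  simp_rw [wordSpan, words_eq_pow, span_pow, insert_one_pow_eq_setOf_exists_mem_pow]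

theorem span_insert_one_pow_le_adjoin (k : ℕ) :
    span F (insert 1 S) ^ k ≤ Subalgebra.toSubmodule (Algebra.adjoin F S) := by
  have hle : span F (insert 1 S) ≤ Subalgebra.toSubmodule (Algebra.adjoin F S) :=
    span_le.2 (Set.insert_subset (one_mem (Algebra.adjoin F S)) Algebra.subset_adjoin)
  induction k with
  | zero =>
    rw [pow_zero]
    exact Submodule.one_le.2 (one_mem (Algebra.adjoin F S))
  | succ k ih =>
    rw [pow_succ]
    exact Submodule.mul_le.2 fun x hx y hy => (Algebra.adjoin F S).mul_mem (ih hx) (hle hy)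

theorem adjoin_le_span_insert_one_pow {k : ℕ}
    (h : span F (insert 1 S) ^ (k + 1) ≤ span F (insert 1 S) ^ k) :
    Subalgebra.toSubmodule (Algebra.adjoin F S) ≤ span F (insert 1 S) ^ k := by
  have hle := pow_le_of_pow_succ_le one_le_span_insert_one h
  have hone : (1 : A) ∈ span F (insert 1 S) ^ k :=
    Submodule.one_le.1 (one_le_pow_of_one_le' one_le_span_insert_one k)
  let B : Subalgebra F A := (span F (insert 1 S) ^ k).toSubalgebra hone fun x y hx hy =>
    hle (k + k) (pow_add (span F (insert 1 S)) k k ▸ mul_mem_mul hx hy)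
  suffices Algebra.adjoin F S ≤ B from this
  refine Algebra.adjoin_le fun s hs => hle 1 ?_
  rw [pow_one]
  exact subset_span (Set.mem_insert_of_mem 1 hs)

theorem mem_spanningLengths_iff {k : ℕ} :
    k ∈ spanningLengths F S ↔ span F (insert 1 S) ^ (k + 1) ≤ span F (insert 1 S) ^ k := by
  rw [spanningLengths, Set.mem_ofPred_eq, wordSpan_eq_pow]
  refine ⟨fun h => ?_, fun h => ?_⟩
  · exact h ▸ span_insert_one_pow_le_adjoin (k + 1)
  · exact le_antisymm (span_insert_one_pow_le_adjoin k) (adjoin_le_span_insert_one_pow h)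

theorem exists_mem_spanningLengths {V : Type*} [AddCommGroup V] [Module F V]
    [FiniteDimensional F V] [Nontrivial V] {ρ : A →ₐ[F] End F V} (hρ : Function.Injective ρ)
    (S : Set A) : ∃ k ∈ spanningLengths F S, (k : ℝ) ≤ lengthBound (finrank F V) := by
  have hone : 1 ≤ (span F (insert 1 S)).map ρ.toLinearMap :=
    Submodule.one_le.2 ⟨1, Submodule.one_le.1 one_le_span_insert_one, map_one ρ⟩
  obtain ⟨k, hk, hle⟩ := exists_pow_succ_le hone
  rw [← Submodule.map_pow, ← Submodule.map_pow] at hle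
  exact ⟨k, mem_spanningLengths_iff.2 ((map_le_map_iff_of_injective hρ _ _).1 hle), hk⟩

theorem isLeast_spanningLengths_setLength (h : (spanningLengths F S).Nonempty) :
    IsLeast (spanningLengths F S) (setLength F S) :=
  ⟨Nat.sInf_mem h, fun _ hk => Nat.sInf_le hk⟩

theorem isGreatest_generatingLengths_algLength {B : ℝ} (h : ∀ S : Set A, (setLength F S : ℝ) ≤ B) :
    IsGreatest (generatingLengths F A) (algLength F A) := by
  have hbdd : BddAbove (generatingLengths F A) := by
    refine ⟨⌊B⌋₊, ?_⟩
    rintro _ ⟨S, _, rfl⟩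
    exact Nat.le_floor (h S)
  exact ⟨Nat.sSup_mem ⟨_, Set.univ, Algebra.adjoin_univ F A, rfl⟩ hbdd,
    fun _ hm => le_csSup hbdd hm⟩

end Words

end MatrixLength

open MatrixLength Module in
theorem theorem1_general {F A V : Type*} [Field F] [Ring A] [Algebra F A] [AddCommGroup V]
    [Module F V] [FiniteDimensional F V] [Nontrivial V] (ρ : A →ₐ[F] End F V)
    (hρ : Function.Injective ρ) :
    (∀ S : Set A, IsLeast (spanningLengths F S) (setLength F S) ∧
      (setLength F S : ℝ) ≤ lengthBound (finrank F V)) ∧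
    IsGreatest (generatingLengths F A) (algLength F A) ∧
    (algLength F A : ℝ) ≤ lengthBound (finrank F V) := by
  have hS (S : Set A) : IsLeast (spanningLengths F S) (setLength F S) ∧
      (setLength F S : ℝ) ≤ lengthBound (finrank F V) := by
    obtain ⟨k, hk, hle⟩ := exists_mem_spanningLengths hρ S
    have hleast := isLeast_spanningLengths_setLength ⟨k, hk⟩
    exact ⟨hleast, (Nat.cast_le.2 (hleast.2 hk)).trans hle⟩
  have hgreatest := isGreatest_generatingLengths_algLength fun S => (hS S).2
  obtain ⟨S, -, hlength⟩ := hgreatest.1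
  exact ⟨hS, hgreatest, hlength ▸ (hS S).2⟩

/-- The memberships in `IsLeast` and `IsGreatest` say that the minimum `ℓ(S)` and the maximum
`ℓ(Mat_n(F))` are attained, so neither of them is a default value. -/
theorem theorem1 :
    (∀ (F : Type u) [Field F] (n : ℕ), 1 ≤ n →
      (∀ S : Set (Matrix (Fin n) (Fin n) F),
        IsLeast (MatrixLength.spanningLengths F S) (MatrixLength.setLength F S) ∧
        (MatrixLength.setLength F S : ℝ) ≤ 2 * n * Real.logb 2 n + 4 * n - 4) ∧
      IsGreatest (MatrixLength.generatingLengths F (Matrix (Fin n) (Fin n) F))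
        (MatrixLength.algLength F (Matrix (Fin n) (Fin n) F)) ∧
      (MatrixLength.algLength F (Matrix (Fin n) (Fin n) F) : ℝ) ≤
        2 * n * Real.logb 2 n + 4 * n - 4) ∧
    (∃ C : ℝ, ∀ (F : Type u) [Field F] (n : ℕ), 2 ≤ n →
      (MatrixLength.algLength F (Matrix (Fin n) (Fin n) F) : ℝ) ≤
        C * (n * Real.log n)) := by
  have h (F : Type u) [Field F] (n : ℕ) (hn : 1 ≤ n) :=
    have : Nonempty (Fin n) := ⟨⟨0, hn⟩⟩
    theorem1_general (Matrix.toLinAlgEquiv' (R := F) (n := Fin n)).toAlgHom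
      Matrix.toLinAlgEquiv'.injective
  simp only [Module.finrank_fin_fun] at h
  refine ⟨fun F _ n hn => ?_, 4 / Real.log 2, fun F _ n hn => ?_⟩
  · have hle := MatrixLength.lengthBound_le hn
    obtain ⟨hS, hgreatest, hlength⟩ := h F n hn
    exact ⟨fun S => (hS S).imp_right hle.trans', hgreatest, hlength.trans hle⟩
  · exact (h F n (by omega)).2.2.trans (MatrixLength.lengthBound_le_mul_log hn)
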